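/- Let $\mathbb{F}_q$ be any finite field with $q$ elements, and let $S\subseteq\mathbb{F}_q\setminus\{0\}$ be symmetric, i.e. $S=-S$. Let $G=\Gamma(\mathbb{F}_q,S)$ be the graph with vertex set $\mathbb{F}_q$ in which $u$ and $v$ are adjacent if and only if $v-u\in S$. Its complement is $\overline G=\Gamma(\mathbb{F}_q,\overline S)$ with $\overline S=(\mathbb{F}_q\setminus\{0\})\setminus S$. Put $$\rho_{\mathrm{lin}}(G)=q^{\,1-\frac{|S|}{q-1}},\qquad \rho_{\mathrm{lin}}(\overline G)=q^{\,1-\frac{|\overline S|}{q-1}}.$$ Let $\vartheta$ denote the Lovász theta function, that is, $\vartheta(H)=\min_{c,(u_i)}\max_{i\in V(H)}\langle c,u_i\rangle^{-2}$, where $c$ ranges over the unit vectors and $(u_i)_{i\in V(H)}$ over the families of unit vectors of a Euclidean space of arbitrary finite dimension such that $\langle u_i,u_j\rangle=0$ whenever $i\ne j$ are not adjacent in $H$ (with $0^{-2}=\infty$). Then $$\rho_{\mathrm{lin}}(G)\,\rho_{\mathrm{lin}}(\overline G)=q=\vartheta(G)\,\vartheta(\overline G),$$ and one of the following holds: (a)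 $\rho_{\mathrm{lin}}(G)=\vartheta(G)$ and $\rho_{\mathrm{lin}}(\overline G)=\vartheta(\overline G)$; (b) for one of the graphs $G$ and $\overline G$, the bound $\rho_{\mathrm{lin}}$ is strictly smaller than the Lovász theta function: $\rho_{\mathrm{lin}}(G)<\vartheta(G)$ or $\rho_{\mathrm{lin}}(\overline G)<\vartheta(\overline G)$. -/

import Mathlib

/-- The Cayley graph `Γ(F, S)` over the additive group of `F`. -/
abbrev cayleyGraph {F : Type*} [Field F] (S : Finset F) : SimpleGraph F :=
  SimpleGraph.addCayley (S : Set F)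

/-- For symmetric `S` with `0 ∉ S`, the vertices `v` and `u` are adjacent iff `v - u ∈ S`. -/
theorem cayleyGraph_adj_iff {F : Type*} [Field F] {S : Finset F}
    (h0 : (0 : F) ∉ S) (hS : ∀ x ∈ S, -x ∈ S) (v u : F) :
    (cayleyGraph S).Adj v u ↔ v - u ∈ S := by
  rw [SimpleGraph.addCayley_adj]
  have e1 : -v + u = -(v - u) := by ring
  have e2 : -u + v = v - u := by ring
  rw [e1, e2]
  constructor
  · rintro ⟨-, h | h⟩
    · have := hS _ h
      rwa [neg_neg] at this
    · exact h
  · intro h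
    refine ⟨?_, Or.inr h⟩
    rintro rfl
    rw [sub_self] at h
    exact h0 h

/-- The complementary connection set `(F \ {0}) \ S`. -/
def complConnectionSet {F : Type*} [Field F] [Fintype F] [DecidableEq F] (S : Finset F) :
    Finset F :=
  (Finset.univ \ {0}) \ S

/-- The complement of `Γ(F, S)` is the Cayley graph of the complementary connection set. -/
theorem compl_cayleyGraph {F : Type*} [Field F] [Fintype F] [DecidableEq F] {S : Finset F}
    (h0 : (0 : F) ∉ S) (hS : ∀ x ∈ S, -x ∈ S) :
    (cayleyGraph S)ᶜ = cayleyGraph (complConnectionSet S) := by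
  have h0' : (0 : F) ∉ complConnectionSet S := by simp [complConnectionSet]
  have hS' : ∀ x ∈ complConnectionSet S, -x ∈ complConnectionSet S := by
    intro x hx
    simp only [complConnectionSet, Finset.mem_sdiff, Finset.mem_univ, true_and,
      Finset.mem_singleton, neg_eq_zero] at hx ⊢
    refine ⟨hx.1, fun h => hx.2 ?_⟩
    have := hS _ h
    rwa [neg_neg] at this
  ext v u
  rw [SimpleGraph.compl_adj, cayleyGraph_adj_iff h0 hS, cayleyGraph_adj_iff h0' hS']
  simp [complConnectionSet, sub_eq_zero]

/-- The bound `ρ_lin(Γ(F, S)) = q ^ (1 - |S| / (q - 1))`, where `q = |F|`. -/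
noncomputable def rhoLin {F : Type*} [Field F] [Fintype F] (S : Finset F) : ℝ :=
  (Fintype.card F : ℝ) ^ (1 - (S.card : ℝ) / ((Fintype.card F : ℝ) - 1))

/-- An orthonormal representation of `G` in `ℝ ^ N`: unit vectors attached to the vertices, such
that distinct non-adjacent vertices get orthogonal vectors. -/
structure IsOrthonormalRep {V : Type*} (G : SimpleGraph V) {N : ℕ}
    (u : V → EuclideanSpace ℝ (Fin N)) : Prop where
  norm_eq_one : ∀ i, ‖u i‖ = 1
  inner_eq_zero : ∀ i j, i ≠ j → ¬ G.Adj i j → inner ℝ (u i) (u j) = 0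

/-- The Lovász theta function of a finite graph: the infimum, over all orthonormal representations
`u` of `G` (in any dimension) and all unit vectors `c`, of `max_i 1 / ⟪c, u i⟫ ^ 2`. Pairs with
`⟪c, u i⟫ = 0` for some `i` have value `∞`, hence do not contribute. -/
noncomputable def lovaszTheta {V : Type*} [Fintype V] (G : SimpleGraph V) : ℝ :=
  sInf {t : ℝ | ∃ (N : ℕ) (u : V → EuclideanSpace ℝ (Fin N)) (c : EuclideanSpace ℝ (Fin N)),
    IsOrthonormalRep G u ∧ ‖c‖ = 1 ∧ (∀ i, inner ℝ c (u i) ≠ 0) ∧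
      t = ⨆ i, 1 / (inner ℝ c (u i)) ^ 2}

/-! The bounds `rhoLin` multiply to q because |S| and the size of its complement in the nonzero
elements add up to q - 1. For theta, tensoring representations of G and of its complement gives an
orthonormal family, and Bessel's inequality yields ϑ(G)ϑ(Gᶜ) ≥ q
(`card_le_mul_of_mem_lovaszValues`).

The reverse inequality uses translation-invariant Gram matrices, that is, positive semidefinite
functions f with f(0) = 1: if f has the support required by a graph and positive sum, it gives the
value q / ∑ f (`card_div_sum_mem_lovaszValues`). Separating a point from a compact convex set
(`exists_sum_eq_or_exists_le_sum`) provides such an f for G or for Gᶜ with a large enough sum. Two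
pairs of positive numbers with equal products then either agree or have a strict inequality in each
direction. -/

/-! ### Positive semidefinite functions on a finite abelian group -/

open Finset Matrix in
/-- The quadratic form of a circulant matrix is the pairing with an autocorrelation. -/
theorem dotProduct_circulant_mulVec {A : Type*} [AddCommGroup A] [Fintype A] (h φ : A → ℝ) :
    star φ ⬝ᵥ (circulant h *ᵥ φ) = ∑ x, h x * ∑ j, φ (j + x) * φ j := by
  simp only [dotProduct, mulVec, circulant_apply, star_trivial, Finset.mul_sum]
  rw [Finset.sum_comm]
  conv_rhs => rw [Finset.sum_comm]
  refine Finset.sum_congr rfl fun j _ => ?_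
  refine Fintype.sum_equiv (Equiv.subRight j) _ _ fun i => ?_
  simp only [Equiv.subRight_apply, add_sub_cancel]
  ring

open Matrix in
theorem posSemidef_circulant_autocorrelation {A : Type*} [AddCommGroup A] [Fintype A]
    (φ : A → ℝ) : (circulant fun x => ∑ j, φ (j + x) * φ j).PosSemidef := by
  have h : (circulant fun x => ∑ j, φ (j + x) * φ j)
      = (of fun j i => φ (j + i))ᴴ * (of fun j i => φ (j + i)) := by
    ext i k
    simp only [circulant_apply, mul_apply, conjTranspose_apply, of_apply, star_trivial]
    refine (Fintype.sum_equiv (Equiv.addRight k) _ _ fun j => ?_).symm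
    simp only [Equiv.coe_addRight]
    congr 2
    abel
  rw [h]
  exact posSemidef_conjTranspose_mul_self _

theorem Matrix.PosSemidef.apply_neg_of_circulant {A : Type*} [AddCommGroup A] {f : A → ℝ}
    (hf : (circulant f).PosSemidef) (x : A) : f (-x) = f x := by
  have := hf.isHermitian.apply x 0
  simpa [circulant_apply] using this

open Matrix in
/-- An even function pairing nonnegatively with all normalized positive semidefinite functions is
positive semidefinite. -/
theorem posSemidef_circulant_of_forall_sum_nonneg {A : Type*} [AddCommGroup A] [Fintype A]
    {h : A → ℝ} (heven : ∀ x, h (-x) = h x)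
    (hpos : ∀ f : A → ℝ, (circulant f).PosSemidef → f 0 = 1 → 0 ≤ ∑ x, h x * f x) :
    (circulant h).PosSemidef := by
  refine .of_dotProduct_mulVec_nonneg ?_ fun φ => ?_
  · ext i j
    simp [circulant_apply, ← heven (i - j)]
  · rw [dotProduct_circulant_mulVec]
    have hr := posSemidef_circulant_autocorrelation φ
    set r : A → ℝ := fun x => ∑ j, φ (j + x) * φ j with hrdef
    have hr0 : r 0 = ∑ j, φ j * φ j := by simp [r]
    change 0 ≤ ∑ x, h x * r x
    have hnn : 0 ≤ r 0 := by
      rw [hr0]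
      exact Finset.sum_nonneg fun j _ => mul_self_nonneg _
    rcases hnn.eq_or_lt with hz | hlt
    · have hφ : ∀ j, φ j = 0 := by
        intro j
        rw [hr0, eq_comm, Finset.sum_eq_zero_iff_of_nonneg fun j _ => mul_self_nonneg _] at hz
        exact mul_self_eq_zero.1 (hz j (Finset.mem_univ j))
      simp [r, hφ]
    · have key := hpos ((r 0)⁻¹ • r) (by
        rw [circulant_smul]; exact hr.smul (inv_nonneg.2 hnn)) (by simp [hlt.ne'])
      have e : ∑ x, h x * ((r 0)⁻¹ • r) x = (r 0)⁻¹ * ∑ x, h x * r x := by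
        rw [Finset.mul_sum]
        exact Finset.sum_congr rfl fun x _ => by simp only [Pi.smul_apply, smul_eq_mul]; ring
      rw [e] at key
      exact nonneg_of_mul_nonneg_right key (inv_pos.2 hlt)

open Matrix in
open scoped MatrixOrder Matrix.Norms.L2Operator in
/-- A positive semidefinite real matrix is a Gram matrix. -/
theorem Matrix.PosSemidef.exists_inner_eq {V : Type*} [Fintype V]
    {M : Matrix V V ℝ} (hM : M.PosSemidef) :
    ∃ (N : ℕ) (u : V → EuclideanSpace ℝ (Fin N)), ∀ i j, inner ℝ (u i) (u j) = M i j := by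
  classical
  obtain ⟨B, rfl⟩ : ∃ B : Matrix V V ℝ, M = Bᴴ * B :=
    CStarAlgebra.nonneg_iff_eq_star_mul_self.mp hM.nonneg
  refine ⟨Fintype.card V, fun i => WithLp.toLp 2 fun k => B ((Fintype.equivFin V).symm k) i,
    fun i j => ?_⟩
  simp only [PiLp.inner_apply, RCLike.inner_apply, conj_trivial, mul_apply, conjTranspose_apply,
    star_trivial]
  rw [Equiv.sum_comp (Fintype.equivFin V).symm fun k => B k j * B k i]
  exact Finset.sum_congr rfl fun k _ => mul_comm _ _

/-- Cauchy–Schwarz for the Gram vectors, which all have squared norm `f 0`. -/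
theorem Matrix.PosSemidef.abs_apply_le_of_circulant {A : Type*} [AddCommGroup A] [Fintype A]
    {f : A → ℝ} (hf : (circulant f).PosSemidef) (x : A) : |f x| ≤ f 0 := by
  obtain ⟨N, u, hu⟩ := hf.exists_inner_eq
  have hn : ∀ i, ‖u i‖ * ‖u i‖ = f 0 := fun i => by
    rw [← real_inner_self_eq_norm_mul_norm, hu, circulant_apply, sub_self]
  have h := abs_real_inner_le_norm (u x) (u 0)
  rw [hu, circulant_apply, sub_zero] at h
  nlinarith [hn x, hn 0, sq_nonneg (‖u x‖ - ‖u 0‖)]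

/-- The normalized positive semidefinite functions on a finite abelian group. -/
def normalizedPosSemidef (A : Type*) [AddCommGroup A] : Set (A → ℝ) :=
  {f | (Matrix.circulant f).PosSemidef ∧ f 0 = 1}

open Matrix in
theorem isCompact_normalizedPosSemidef (A : Type*) [AddCommGroup A] [Fintype A] :
    IsCompact (normalizedPosSemidef A) := by
  refine (isCompact_univ_pi fun _ : A => isCompact_Icc (a := (-1 : ℝ)) (b := 1)).of_isClosed_subset
    ?_ fun f hf x _ => ?_
  · have e : normalizedPosSemidef A = {f : A → ℝ | (circulant f).IsHermitian} ∩
        (⋂ φ : A → ℝ, {f : A → ℝ | 0 ≤ star φ ⬝ᵥ (circulant f *ᵥ φ)}) ∩ {f | f 0 = 1} := by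
      ext f
      simp [normalizedPosSemidef, posSemidef_iff_dotProduct_mulVec]
    have hc : Continuous fun f : A → ℝ => circulant f :=
      continuous_matrix fun i j => continuous_apply (i - j)
    rw [e]
    refine ((isClosed_eq hc.matrix_conjTranspose hc).inter
      (isClosed_iInter fun φ => isClosed_le continuous_const ?_)).inter
      (isClosed_eq (continuous_apply _) continuous_const)
    exact continuous_const.dotProduct (hc.matrix_mulVec continuous_const)
  · exact abs_le.1 ((hf.1.abs_apply_le_of_circulant x).trans_eq hf.2)

theorem convex_normalizedPosSemidef (A : Type*) [AddCommGroup A] :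
    Convex ℝ (normalizedPosSemidef A) := by
  rintro f ⟨hf, hf0⟩ g ⟨hg, hg0⟩ a b ha hb hab
  refine ⟨?_, by simp [hf0, hg0, hab]⟩
  rw [Matrix.circulant_add, Matrix.circulant_smul, Matrix.circulant_smul]
  exact (hf.smul ha).add (hg.smul hb)

theorem single_mem_normalizedPosSemidef (A : Type*) [AddCommGroup A] [DecidableEq A] :
    Pi.single 0 1 ∈ normalizedPosSemidef A := by
  refine ⟨?_, by simp⟩
  rw [Matrix.circulant_single_one]
  exact Matrix.PosSemidef.one

theorem posSemidef_circulant_one (A : Type*) [AddCommGroup A] [Fintype A] :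
    (Matrix.circulant fun _ : A => (1 : ℝ)).PosSemidef := by
  have e : (Matrix.circulant fun _ : A => (1 : ℝ))
      = Matrix.vecMulVec (fun _ => 1) (star fun _ => 1) := by
    ext i j
    simp [Matrix.circulant_apply, Matrix.vecMulVec_apply]
  rw [e]
  exact Matrix.posSemidef_vecMulVec_self_star _

theorem Matrix.PosSemidef.sum_nonneg_of_circulant {A : Type*} [AddCommGroup A] [Fintype A]
    [Nonempty A] {f : A → ℝ} (hf : (circulant f).PosSemidef) : 0 ≤ ∑ x, f x := by
  have h := hf.dotProduct_mulVec_nonneg (fun _ => 1)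
  rw [dotProduct_circulant_mulVec] at h
  simp only [mul_one, Finset.sum_const, Finset.card_univ, nsmul_eq_mul, ← Finset.sum_mul] at h
  exact nonneg_of_mul_nonneg_left h (by exact_mod_cast Fintype.card_pos)

/-! ### Conic duality -/

/-- Conic duality for positive semidefinite functions with prescribed support: either the sum `τ`
is attained by a function vanishing on `T`, or a function supported on `T ∪ {0}` has sum at least
`|A| / τ`. -/
theorem exists_sum_eq_or_exists_le_sum {A : Type*} [AddCommGroup A] [Fintype A] [DecidableEq A]
    {T : Finset A} (hT0 : (0 : A) ∉ T) (hT : ∀ x ∈ T, -x ∈ T) {τ : ℝ} (hτ : 1 < τ) :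
    (∃ f ∈ normalizedPosSemidef A, (∀ x ∈ T, f x = 0) ∧ ∑ x, f x = τ) ∨
      ∃ g ∈ normalizedPosSemidef A, (∀ x, x ≠ 0 → x ∉ T → g x = 0) ∧
        (Fintype.card A : ℝ) / τ ≤ ∑ x, g x := by
  refine or_iff_not_imp_left.2 fun hno => ?_
  -- Records the sum and the restriction to `T`; failure of the first alternative says that `(τ, 0)`
  -- is not in the image.
  let π : (A → ℝ) →ₗ[ℝ] ℝ × (A → ℝ) :=
    (∑ x, LinearMap.proj x).prod (LinearMap.pi fun x => if x ∈ T then LinearMap.proj x else 0)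
  have hπ1 : ∀ f, (π f).1 = ∑ x, f x := fun f => by simp [π]
  have hπ2 : ∀ f x, (π f).2 x = if x ∈ T then f x else 0 := fun f x => by
    by_cases hx : x ∈ T <;> simp [π, hx]
  have hcomp : IsCompact (π '' normalizedPosSemidef A) :=
    (isCompact_normalizedPosSemidef A).image π.continuous_of_finiteDimensional
  have hmem : ((τ, 0) : ℝ × (A → ℝ)) ∉ π '' normalizedPosSemidef A := by
    rintro ⟨f, hf, hfe⟩
    refine hno ⟨f, hf, fun x hx => ?_, ?_⟩
    · have := hπ2 f x
      rw [hfe, if_pos hx] at this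
      exact this.symm
    · rw [← hπ1, hfe]
  obtain ⟨l, v, hl, hv⟩ := geometric_hahn_banach_closed_point
    ((convex_normalizedPosSemidef A).linear_image π) hcomp.isClosed hmem
  set β : ℝ := l (1, 0) with hβ
  set y : A → ℝ := fun x => l (0, Pi.single x 1) with hy
  have hl' : ∀ p : ℝ × (A → ℝ), l p = β * p.1 + ∑ x, y x * p.2 x := by
    rintro ⟨r, z⟩
    have e1 : ((r, z) : ℝ × (A → ℝ)) = r • (1, 0) + ∑ x, z x • (0, Pi.single x 1) := by
      refine Prod.ext ?_ ?_
      · simp [Prod.fst_sum]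
      · ext k
        simp [Prod.snd_sum, Finset.sum_apply, Pi.single_apply]
    rw [e1, map_add, map_smul, map_sum, ← e1]
    simp only [map_smul, smul_eq_mul, hβ, hy, mul_comm]
  have hpair : ∀ f ∈ normalizedPosSemidef A,
      β * ∑ x, f x + ∑ x ∈ T, y x * f x < β * τ := by
    intro f hf
    have h := (hl _ ⟨f, hf, rfl⟩).trans hv
    rw [hl', hl'] at h
    simpa [hπ1, hπ2, Finset.sum_ite_mem] using h
  -- Testing on the delta function at 0 gives `β < β * τ`, and `1 < τ`.
  have hβpos : 0 < β := by
    have h := hpair _ (single_mem_normalizedPosSemidef A)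
    have e : ∑ x ∈ T, y x * (Pi.single 0 1 : A → ℝ) x = 0 :=
      Finset.sum_eq_zero fun x hx => by
        rw [Pi.single_eq_of_ne (by rintro rfl; exact hT0 hx), mul_zero]
    rw [e, Finset.sum_pi_single' ] at h
    simp only [Finset.mem_univ, if_true] at h
    nlinarith
  have hβτ : 0 < β * τ := by positivity
  -- Even part of the separating functional: positive semidefinite functions are even and `T = -T`,
  -- so their pairings do not change.
  set w : A → ℝ := fun x => if x ∈ T then (y x + y (-x)) / 2 else 0 with hw
  have hTneg : ∀ x, -x ∈ T ↔ x ∈ T := fun x =>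
    ⟨fun h => by simpa using hT _ h, hT x⟩
  have hweven : ∀ x, w (-x) = w x := fun x => by
    simp only [hw, hTneg, neg_neg, add_comm]
  have hwpair : ∀ f : A → ℝ, (∀ x, f (-x) = f x) → ∑ x, w x * f x = ∑ x ∈ T, y x * f x := by
    intro f hf
    have e : ∑ x ∈ T, y (-x) * f x = ∑ x ∈ T, y x * f x :=
      Finset.sum_nbij' (fun x => -x) (fun x => -x) (fun x hx => hT x hx) (fun x hx => hT x hx)
        (fun x _ => neg_neg x) (fun x _ => neg_neg x) fun x _ => by rw [hf]
    calc ∑ x, w x * f x = ∑ x ∈ T, (y x + y (-x)) / 2 * f x := by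
          simp [hw, ite_mul, Finset.sum_ite_mem]
      _ = (∑ x ∈ T, y x * f x + ∑ x ∈ T, y (-x) * f x) / 2 := by
          rw [← Finset.sum_add_distrib, Finset.sum_div]
          exact Finset.sum_congr rfl fun x _ => by ring
      _ = _ := by rw [e]; ring
  -- The pairing of `h` with a normalized `f` is the slack in `hpair`.
  set h : A → ℝ := fun x => (if x = 0 then β * τ else 0) - w x - β with hh
  have hpsd : (Matrix.circulant h).PosSemidef := by
    refine posSemidef_circulant_of_forall_sum_nonneg (fun x => ?_) fun f hf hf0 => ?_
    · simp only [hh, hweven, neg_eq_zero]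
    · have e : ∑ x, h x * f x = β * τ - ∑ x ∈ T, y x * f x - β * ∑ x, f x := by
        rw [← hwpair f hf.apply_neg_of_circulant, Finset.mul_sum]
        simp only [hh, sub_mul, Finset.sum_sub_distrib, ite_mul, zero_mul, Finset.sum_ite_eq',
          Finset.mem_univ, if_true, hf0, mul_one]
      have := hpair f ⟨hf, hf0⟩
      linarith
  have hw0 : w 0 = 0 := by simp [hw, hT0]
  -- Adding back `β` clears `h` off `T ∪ {0}` and keeps it positive semidefinite; the sum bound is
  -- then `0 ≤ ∑ h`.
  refine ⟨fun x => (β * τ)⁻¹ * (h x + β), ⟨?_, ?_⟩, fun x hx0 hxT => ?_, ?_⟩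
  · have e : (fun x => (β * τ)⁻¹ * (h x + β)) = (β * τ)⁻¹ • (h + β • fun _ => (1 : ℝ)) := by
      ext x
      simp
    rw [e, Matrix.circulant_smul, Matrix.circulant_add, Matrix.circulant_smul]
    exact (hpsd.add ((posSemidef_circulant_one A).smul hβpos.le)).smul (inv_nonneg.2 hβτ.le)
  · simp only [hh, hw0, if_true]
    field_simp
    ring
  · simp [hh, hw, hx0, hxT]
  · have hs := hpsd.sum_nonneg_of_circulant
    rw [← Finset.mul_sum, Finset.sum_add_distrib, Finset.sum_const, Finset.card_univ,
      nsmul_eq_mul, inv_mul_eq_div, le_div_iff₀ hβτ]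
    have : (Fintype.card A : ℝ) / τ * (β * τ) = Fintype.card A * β := by
      field_simp
    linarith

/-! ### Orthonormal representations and the theta function -/

/-- The values of orthonormal representations, whose infimum is the Lovász theta function. -/
def lovaszValues {V : Type*} (G : SimpleGraph V) : Set ℝ :=
  {t : ℝ | ∃ (N : ℕ) (u : V → EuclideanSpace ℝ (Fin N)) (c : EuclideanSpace ℝ (Fin N)),
    IsOrthonormalRep G u ∧ ‖c‖ = 1 ∧ (∀ i, inner ℝ c (u i) ≠ 0) ∧
      t = ⨆ i, 1 / (inner ℝ c (u i)) ^ 2}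

theorem one_le_of_mem_lovaszValues {V : Type*} [Finite V] [Nonempty V] {G : SimpleGraph V} {t : ℝ}
    (ht : t ∈ lovaszValues G) : 1 ≤ t := by
  obtain ⟨N, u, c, hu, hc, hne, rfl⟩ := ht
  obtain ⟨i⟩ := ‹Nonempty V›
  refine le_trans ?_ (le_ciSup (Set.finite_range _).bddAbove i)
  have h := abs_real_inner_le_norm c (u i)
  rw [hc, hu.norm_eq_one, one_mul] at h
  have hpos : 0 < (inner ℝ c (u i)) ^ 2 := sq_pos_iff.2 (hne i)
  rw [le_div_iff₀ hpos, one_mul]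
  exact (sq_le_one_iff_abs_le_one _).2 h

theorem bddBelow_lovaszValues {V : Type*} [Finite V] [Nonempty V] (G : SimpleGraph V) :
    BddBelow (lovaszValues G) :=
  ⟨1, fun _ ht => one_le_of_mem_lovaszValues ht⟩

/-- The product of the values of representations of `G` and of its complement is at least the
number of vertices. -/
theorem card_le_mul_of_mem_lovaszValues {V : Type*} [Fintype V] [Nonempty V] {G : SimpleGraph V}
    {s t : ℝ} (hs : s ∈ lovaszValues G) (ht : t ∈ lovaszValues Gᶜ) :
    (Fintype.card V : ℝ) ≤ s * t := by
  have hs1 := one_le_of_mem_lovaszValues hs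
  have ht1 := one_le_of_mem_lovaszValues ht
  obtain ⟨N, u, c, hu, hc, hcu, hse⟩ := hs
  obtain ⟨M, v, d, hv, hd, hdv, hte⟩ := ht
  have hs' : ∀ i, 1 / s ≤ (inner ℝ c (u i)) ^ 2 := fun i => by
    have hpos : 0 < (inner ℝ c (u i)) ^ 2 := sq_pos_iff.2 (hcu i)
    rw [div_le_comm₀ (by linarith) hpos, hse]
    exact le_ciSup (f := fun i => 1 / (inner ℝ c (u i)) ^ 2) (Set.finite_range _).bddAbove i
  have ht' : ∀ i, 1 / t ≤ (inner ℝ d (v i)) ^ 2 := fun i => by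
    have hpos : 0 < (inner ℝ d (v i)) ^ 2 := sq_pos_iff.2 (hdv i)
    rw [div_le_comm₀ (by linarith) hpos, hte]
    exact le_ciSup (f := fun i => 1 / (inner ℝ d (v i)) ^ 2) (Set.finite_range _).bddAbove i
  let tens : EuclideanSpace ℝ (Fin N) → EuclideanSpace ℝ (Fin M) →
      EuclideanSpace ℝ (Fin N × Fin M) := fun a b => WithLp.toLp 2 fun p => a p.1 * b p.2
  have htens : ∀ a a' b b', inner ℝ (tens a b) (tens a' b') = inner ℝ a a' * inner ℝ b b' := by
    intro a a' b b'
    simp only [tens, PiLp.inner_apply, RCLike.inner_apply, conj_trivial, Fintype.sum_prod_type,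
      Finset.sum_mul_sum]
    exact Finset.sum_congr rfl fun i _ => Finset.sum_congr rfl fun j _ => by ring
  have hnorm : ∀ a b, ‖a‖ = 1 → ‖b‖ = 1 → ‖tens a b‖ = 1 := by
    intro a b ha hb
    have := htens a a b b
    rw [real_inner_self_eq_norm_sq, real_inner_self_eq_norm_sq, real_inner_self_eq_norm_sq, ha,
      hb] at this
    exact (pow_eq_one_iff_of_nonneg (norm_nonneg _) two_ne_zero).1 (by simpa using this)
  have horth : Orthonormal ℝ fun i => tens (u i) (v i) := by
    refine ⟨fun i => hnorm _ _ (hu.norm_eq_one i) (hv.norm_eq_one i), fun i j hij => ?_⟩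
    change inner ℝ (tens (u i) (v i)) (tens (u j) (v j)) = 0
    rw [htens]
    by_cases hG : G.Adj i j
    · rw [hv.inner_eq_zero i j hij (by simp [hG]), mul_zero]
    · rw [hu.inner_eq_zero i j hij hG, zero_mul]
  -- Each of the |V| squared coefficients of the unit vector `tens c d` is at least `1 / (s * t)`.
  have hbessel := horth.sum_inner_products_le (tens c d) (s := Finset.univ)
  rw [hnorm c d hc hd, one_pow] at hbessel
  have hle : (Fintype.card V : ℝ) * (1 / s * (1 / t)) ≤ 1 := by
    refine le_trans ?_ hbessel
    rw [← nsmul_eq_mul, ← Finset.card_univ, ← Finset.sum_const]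
    refine Finset.sum_le_sum fun i _ => ?_
    rw [real_inner_comm, htens, Real.norm_eq_abs, sq_abs, mul_pow]
    exact mul_le_mul (hs' i) (ht' i) (by positivity) (by positivity)
  have hst : 0 < s * t := by positivity
  rwa [one_div_mul_one_div, mul_one_div, div_le_one hst] at hle

/-- A translation invariant Gram matrix gives an orthonormal representation of a graph. -/
theorem card_div_sum_mem_lovaszValues {A : Type*} [AddCommGroup A] [Fintype A]
    {G : SimpleGraph A} {f : A → ℝ} (hf : f ∈ normalizedPosSemidef A)
    (hG : ∀ i j, i ≠ j → ¬ G.Adj i j → f (i - j) = 0) (hpos : 0 < ∑ x, f x) :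
    (Fintype.card A : ℝ) / ∑ x, f x ∈ lovaszValues G := by
  obtain ⟨N, u, hu⟩ := hf.1.exists_inner_eq
  simp only [Matrix.circulant_apply] at hu
  set σ := ∑ x, f x with hσ
  have hn : (0 : ℝ) < Fintype.card A := by exact_mod_cast Fintype.card_pos
  -- By translation invariance the sum of all vectors makes the same inner product with each, so it
  -- serves as handle after normalization.
  have hsum : ∀ i, inner ℝ (∑ j, u j) (u i) = σ := fun i => by
    rw [sum_inner, hσ]
    simp only [hu]
    exact Fintype.sum_equiv (Equiv.subRight i) _ _ fun j => rfl
  have hnorm : ‖∑ j, u j‖ ^ 2 = Fintype.card A * σ := by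
    rw [← real_inner_self_eq_norm_sq, inner_sum]
    simp [hsum]
  have hnpos : 0 < ‖∑ j, u j‖ := by
    refine (norm_nonneg _).lt_of_ne fun h => ?_
    rw [← h] at hnorm
    have : 0 < (Fintype.card A : ℝ) * σ := by positivity
    linarith
  have hc : ∀ i, inner ℝ (‖∑ j, u j‖⁻¹ • ∑ j, u j) (u i) = σ / ‖∑ j, u j‖ := fun i => by
    rw [real_inner_smul_left, hsum, inv_mul_eq_div]
  refine ⟨N, u, ‖∑ j, u j‖⁻¹ • ∑ j, u j, ⟨fun i => ?_, fun i j hij hadj => ?_⟩, ?_, fun i => ?_, ?_⟩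
  · have h := hu i i
    rw [sub_self, hf.2, real_inner_self_eq_norm_sq] at h
    exact (pow_eq_one_iff_of_nonneg (norm_nonneg _) two_ne_zero).1 h
  · rw [hu, hG i j hij hadj]
  · rw [norm_smul, norm_inv, norm_norm, inv_mul_cancel₀ hnpos.ne']
  · rw [hc]
    positivity
  · simp only [hc]
    rw [ciSup_const, div_pow, hnorm]
    field_simp

theorem card_le_lovaszTheta_mul_compl {V : Type*} [Fintype V] [Nonempty V] (G : SimpleGraph V)
    (h1 : (lovaszValues G).Nonempty) (h2 : (lovaszValues Gᶜ).Nonempty) :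
    (Fintype.card V : ℝ) ≤ lovaszTheta G * lovaszTheta Gᶜ := by
  change _ ≤ sInf (lovaszValues G) * sInf (lovaszValues Gᶜ)
  have hp1 : 0 < sInf (lovaszValues Gᶜ) :=
    zero_lt_one.trans_le (le_csInf h2 fun _ => one_le_of_mem_lovaszValues)
  rw [← div_le_iff₀ hp1]
  refine le_csInf h1 fun s hs => ?_
  have hs0 : 0 < s := zero_lt_one.trans_le (one_le_of_mem_lovaszValues hs)
  rw [div_le_iff₀ hp1, ← div_le_iff₀' hs0]
  refine le_csInf h2 fun t ht => ?_
  rw [div_le_iff₀' hs0]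
  exact card_le_mul_of_mem_lovaszValues hs ht

/-- Comes from an orthonormal family, the Gram matrix being the identity; it shows that the infimum
is over a nonempty set. -/
theorem card_mem_lovaszValues {A : Type*} [AddCommGroup A] [Fintype A] (G : SimpleGraph A) :
    (Fintype.card A : ℝ) ∈ lovaszValues G := by
  classical
  have h := card_div_sum_mem_lovaszValues (G := G) (single_mem_normalizedPosSemidef A)
    (fun i j hij _ => Pi.single_eq_of_ne (sub_ne_zero.2 hij) _) (by simp)
  simpa using h

theorem lovaszTheta_pos {A : Type*} [AddCommGroup A] [Fintype A] (G : SimpleGraph A) :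
    0 < lovaszTheta G :=
  zero_lt_one.trans_le (le_csInf ⟨_, card_mem_lovaszValues G⟩ fun _ => one_le_of_mem_lovaszValues)

/-- Lovász's identity `ϑ(G) ϑ(Gᶜ) = |V|` for Cayley graphs. -/
theorem lovaszTheta_cayleyGraph_mul_compl {F : Type*} [Field F] [Fintype F] [DecidableEq F]
    {S : Finset F} (h0 : (0 : F) ∉ S) (hS : ∀ x ∈ S, -x ∈ S) :
    lovaszTheta (cayleyGraph S) * lovaszTheta (cayleyGraph S)ᶜ = (Fintype.card F : ℝ) := by
  set G := cayleyGraph S with hGdef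
  have hadj : ∀ i j, G.Adj i j ↔ i - j ∈ S := cayleyGraph_adj_iff h0 hS
  refine le_antisymm ?_ (card_le_lovaszTheta_mul_compl G ⟨_, card_mem_lovaszValues G⟩
    ⟨_, card_mem_lovaszValues Gᶜ⟩)
  have hθ := lovaszTheta_pos G
  have hn : (0 : ℝ) < Fintype.card F := by exact_mod_cast Fintype.card_pos
  rw [← le_div_iff₀' hθ]
  -- For τ > q/ϑ(G), the first alternative of the duality would give G the value q/τ < ϑ(G); the
  -- second gives Gᶜ a value at most τ.
  refine le_of_forall_gt_imp_ge_of_dense fun τ hτ => ?_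
  have hle : lovaszTheta G ≤ Fintype.card F :=
    csInf_le (bddBelow_lovaszValues G) (card_mem_lovaszValues G)
  have hτ1 : 1 < τ := ((one_le_div₀ hθ).2 hle).trans_lt hτ
  have hT0 : (0 : F) ∉ complConnectionSet S := by simp [complConnectionSet]
  have hT : ∀ x ∈ complConnectionSet S, -x ∈ complConnectionSet S := by
    intro x hx
    simp only [complConnectionSet, Finset.mem_sdiff, Finset.mem_univ, true_and,
      Finset.mem_singleton, neg_eq_zero] at hx ⊢
    exact ⟨hx.1, fun h => hx.2 (by simpa using hS _ h)⟩
  rcases exists_sum_eq_or_exists_le_sum hT0 hT hτ1 with ⟨f, hf, hfT, hfs⟩ | ⟨g, hg, hgT, hgs⟩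
  · have hmem := card_div_sum_mem_lovaszValues (G := G) hf (fun i j hij hna => hfT _ (by
      rw [hadj] at hna
      simp [complConnectionSet, hna, sub_ne_zero.2 hij])) (by rw [hfs]; linarith)
    rw [hfs] at hmem
    have h : lovaszTheta G ≤ Fintype.card F / τ := csInf_le (bddBelow_lovaszValues G) hmem
    rw [div_lt_comm₀ hθ (by linarith)] at hτ
    linarith
  · have hpos : 0 < ∑ x, g x := lt_of_lt_of_le (by positivity) hgs
    have hmem := card_div_sum_mem_lovaszValues (G := Gᶜ) hg (fun i j hij hna => hgT _
      (sub_ne_zero.2 hij) (by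
        rw [SimpleGraph.compl_adj, hadj] at hna
        simp only [ne_eq, hij, not_false_eq_true, true_and, not_not] at hna
        simp [complConnectionSet, hna])) hpos
    refine (csInf_le (bddBelow_lovaszValues Gᶜ) hmem).trans ?_
    rwa [div_le_comm₀ hpos (by linarith)]

/-! ### The linear bound and the dichotomy -/

theorem rhoLin_mul_rhoLin_complConnectionSet {F : Type*} [Field F] [Fintype F] [DecidableEq F]
    {S : Finset F} (h0 : (0 : F) ∉ S) :
    rhoLin S * rhoLin (complConnectionSet S) = (Fintype.card F : ℝ) := by
  have hq : (1 : ℝ) < Fintype.card F := by exact_mod_cast Fintype.one_lt_card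
  have hcard : (S.card : ℝ) + (complConnectionSet S).card = (Fintype.card F : ℝ) - 1 := by
    have hsub : S ⊆ Finset.univ \ {0} := fun x hx => by
      simp only [Finset.mem_sdiff, Finset.mem_univ, Finset.mem_singleton, true_and]
      rintro rfl
      exact h0 hx
    have h1 := Finset.card_sdiff_add_card_eq_card hsub
    have h2 := Finset.card_sdiff_add_card_eq_card (Finset.subset_univ ({0} : Finset F))
    rw [Finset.card_singleton, Finset.card_univ] at h2
    rw [eq_sub_iff_add_eq, ← h2, ← h1, complConnectionSet]
    push_cast
    ring
  rw [rhoLin, rhoLin, ← Real.rpow_add (by linarith)]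
  have e : (1 - (S.card : ℝ) / ((Fintype.card F : ℝ) - 1)) +
      (1 - ((complConnectionSet S).card : ℝ) / ((Fintype.card F : ℝ) - 1)) = 1 := by
    have : (Fintype.card F : ℝ) - 1 ≠ 0 := by linarith
    field_simp
    linarith
  rw [e, Real.rpow_one]

theorem corollary1 {F : Type*} [Field F] [Fintype F] [DecidableEq F] (S : Finset F)
    (h0 : (0 : F) ∉ S) (hS : ∀ x ∈ S, -x ∈ S) :
    (rhoLin S * rhoLin (complConnectionSet S) = (Fintype.card F : ℝ) ∧
      lovaszTheta (cayleyGraph S) * lovaszTheta (cayleyGraph S)ᶜ = (Fintype.card F : ℝ)) ∧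
    ((rhoLin S = lovaszTheta (cayleyGraph S) ∧
        rhoLin (complConnectionSet S) = lovaszTheta (cayleyGraph S)ᶜ) ∨
      (rhoLin S < lovaszTheta (cayleyGraph S) ∨
        rhoLin (complConnectionSet S) < lovaszTheta (cayleyGraph S)ᶜ)) := by
  have hρ := rhoLin_mul_rhoLin_complConnectionSet h0
  have hθ := lovaszTheta_cayleyGraph_mul_compl h0 hS
  refine ⟨⟨hρ, hθ⟩, ?_⟩
  by_contra! hcon
  obtain ⟨hne, h1, h2⟩ := hcon
  have hp1 := lovaszTheta_pos (cayleyGraph S)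
  have hp2 := lovaszTheta_pos (cayleyGraph S)ᶜ
  have hr1 : 0 < rhoLin S := hp1.trans_le h1
  -- Both linear bounds are now at least theta, so equality of the products forces equality of the
  -- factors.
  have e1 : rhoLin S = lovaszTheta (cayleyGraph S) := by
    refine le_antisymm (le_of_mul_le_mul_right ?_ hp2) h1
    calc rhoLin S * lovaszTheta (cayleyGraph S)ᶜ ≤ rhoLin S * rhoLin (complConnectionSet S) :=
          mul_le_mul_of_nonneg_left h2 hr1.le
      _ = lovaszTheta (cayleyGraph S) * lovaszTheta (cayleyGraph S)ᶜ := hρ.trans hθ.symm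
  refine hne e1 (mul_left_cancel₀ hr1.ne' ?_)
  rw [hρ, ← hθ, e1]
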